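/- Let $\kappa$ be an infinite regular cardinal. A $\kappa$-Boolean algebra is a Boolean algebra in which every family of fewer than $\kappa$ elements has a join; $\kappa\mathsf{Bool}$ is the category of $\kappa$-Boolean algebras and Boolean homomorphisms preserving joins of families of fewer than $\kappa$ elements. Let $\kappa\mathsf{Bool}_\kappa \subseteq \kappa\mathsf{Bool}$ be the full subcategory of $\kappa$-presented algebras, i.e. those isomorphic to a quotient of the free $\kappa$-Boolean algebra on fewer than $\kappa$ generators by a congruence generated by fewer than $\kappa$ pairs. For $a \in A$, let $A/a$ be the quotient of $A$ by the congruence generated by the pair $(\top, a)$. For an object $A$ of a category $\mathsf{C}$, $\mathrm{Sub}_{\mathsf{C}}(A)$ is the poset of subobjects of $A$ (equivalence classes of monomorphisms into $A$, ordered by factorization). (1) Every epimorphism in $\kappa\mathsf{Bool}$ is surjective. (2) The category $\kappa\mathsf{Bool}_\kappa^{\mathrm{op}}$ has pullbacks, each poset $\mathrm{Sub}_{\kappa\mathsf{Bool}_\kappa^{\mathrm{op}}}(A)$ is a $\kappa$-presented $\kappa$-Boolean algebra, and for each $f : A \to B$ in $\kappa\mathsf{Bool}_\kappa$ the pullback map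 $\mathrm{Sub}_{\kappa\mathsf{Bool}_\kappa^{\mathrm{op}}}(A) \to \mathrm{Sub}_{\kappa\mathsf{Bool}_\kappa^{\mathrm{op}}}(B)$ along $f : B \to A$ in $\kappa\mathsf{Bool}_\kappa^{\mathrm{op}}$ preserves joins and meets of families of fewer than $\kappa$ elements. For each $\kappa$-presented $\kappa$-Boolean algebra $A$, the algebra $A/a$ is again $\kappa$-presented for every $a \in A$, and the map $$\varphi_A : A \longrightarrow \mathrm{Sub}_{\kappa\mathsf{Bool}_\kappa^{\mathrm{op}}}(A), \qquad a \longmapsto (A \twoheadrightarrow A/a)$$ is a well-defined order isomorphism; moreover $A/a \cong {\downarrow} a$ by an isomorphism under which the projection $A \twoheadrightarrow A/a$ becomes $x \mapsto a \wedge x$. These isomorphisms are natural in $A$: for every homomorphism $f : A \to B$ in $\kappa\mathsf{Bool}_\kappa$ and every $a \in A$, $\varphi_B(f(a))$ is the pullback of the subobject $\varphi_A(a)$ along $f : B \to A$ in $\kappa\mathsf{Bool}_\kappa^{\mathrm{op}}$. -/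

import Mathlib

open CategoryTheory CategoryTheory.Limits Opposite Cardinal

universe u v

/-- A `κ`-complete Boolean algebra (`κ`-Boolean algebra): a Boolean algebra in which every family
of fewer than `κ` elements has a join. -/
structure KBool (κ : Cardinal.{u}) where
  /-- The underlying type. -/
  carrier : Type u
  [str : BooleanAlgebra carrier]
  complete : ∀ (ι : Type u) (f : ι → carrier), #ι < κ → ∃ a, IsLUB (Set.range f) a

namespace KBool

variable {κ : Cardinal.{u}}

instance : CoeSort (KBool κ) (Type u) := ⟨KBool.carrier⟩

instance (A : KBool κ) : BooleanAlgebra A := A.str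

/-- A homomorphism of `κ`-Boolean algebras: a homomorphism of Boolean algebras that preserves
joins of families of fewer than `κ` elements. -/
structure Hom (A B : KBool κ) extends BoundedLatticeHom A B where
  map_isLUB' : ∀ (ι : Type u) (f : ι → A) (a : A), #ι < κ → IsLUB (Set.range f) a →
    IsLUB (Set.range fun i => toFun (f i)) (toFun a)

instance (A B : KBool κ) : FunLike (Hom A B) A B where
  coe f := f.toFun
  coe_injective := by
    rintro ⟨f, _⟩ ⟨g, _⟩ h
    congr
    exact DFunLike.coe_injective h

instance (A B : KBool κ) : BoundedLatticeHomClass (Hom A B) A B where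
  map_sup f := f.map_sup'
  map_inf f := f.map_inf'
  map_top f := f.map_top'
  map_bot f := f.map_bot'

theorem Hom.map_isLUB {A B : KBool κ} (h : Hom A B) {ι : Type u} {f : ι → A} {a : A}
    (hι : #ι < κ) (ha : IsLUB (Set.range f) a) : IsLUB (Set.range fun i => h (f i)) (h a) :=
  h.map_isLUB' ι f a hι ha

/-- The category of `κ`-Boolean algebras. -/
instance : Category (KBool κ) where
  Hom := Hom
  id A := { BoundedLatticeHom.id A with map_isLUB' := fun _ _ _ _ h => h }
  comp f g :=
    { g.toBoundedLatticeHom.comp f.toBoundedLatticeHom with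
      map_isLUB' := fun _ _ _ hι h => g.map_isLUB hι (f.map_isLUB hι h) }

instance : ConcreteCategory (KBool κ) Hom where
  hom f := f
  ofHom f := f

theorem hom_sup {A B : KBool κ} (f : A ⟶ B) (a b : A) : f (a ⊔ b) = f a ⊔ f b :=
  map_sup (ConcreteCategory.hom f) a b

/-! ### Congruences and quotients -/

/-- A congruence on a `κ`-Boolean algebra: an equivalence relation compatible with complements,
binary joins and joins of families of fewer than `κ` elements. -/
structure Congruence (A : KBool κ) extends Setoid A where
  compl' : ∀ a b : A, r a b → r aᶜ bᶜ
  sup' : ∀ a a' b b' : A, r a a' → r b b' → r (a ⊔ b) (a' ⊔ b')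
  isLUB' : ∀ (ι : Type u) (f g : ι → A) (a b : A), #ι < κ → (∀ i, r (f i) (g i)) →
    IsLUB (Set.range f) a → IsLUB (Set.range g) b → r a b

namespace Congruence

variable {A : KBool κ} (c : Congruence A)

theorem inf' (a a' b b' : A) (h : c.r a a') (h' : c.r b b') : c.r (a ⊓ b) (a' ⊓ b') := by
  have := c.compl' _ _ (c.sup' _ _ _ _ (c.compl' _ _ h) (c.compl' _ _ h'))
  simpa [compl_sup] using this

/-- The carrier of the quotient of `A` by the congruence `c`. -/
def Quot : Type u := Quotient c.toSetoid

/-- The class of an element. -/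
def cls (a : A) : c.Quot := Quotient.mk c.toSetoid a

theorem cls_surjective : Function.Surjective c.cls := Quotient.mk_surjective

theorem cls_eq {a b : A} : c.cls a = c.cls b ↔ c.r a b := Quotient.eq (r := c.toSetoid)

instance : Max c.Quot :=
  ⟨Quotient.map₂ (· ⊔ ·) fun _ _ h _ _ h' => c.sup' _ _ _ _ h h'⟩

instance : Min c.Quot :=
  ⟨Quotient.map₂ (· ⊓ ·) fun _ _ h _ _ h' => c.inf' _ _ _ _ h h'⟩

instance : Compl c.Quot := ⟨Quotient.map compl fun _ _ h => c.compl' _ _ h⟩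

theorem cls_sup (a b : A) : c.cls (a ⊔ b) = c.cls a ⊔ c.cls b := rfl

theorem cls_inf (a b : A) : c.cls (a ⊓ b) = c.cls a ⊓ c.cls b := rfl

theorem cls_compl (a : A) : c.cls aᶜ = (c.cls a)ᶜ := rfl

instance : Lattice c.Quot :=
  Lattice.mk'
    (by
      intro x y
      obtain ⟨a, rfl⟩ := c.cls_surjective x
      obtain ⟨b, rfl⟩ := c.cls_surjective y
      rw [← cls_sup, ← cls_sup, sup_comm])
    (by
      intro x y z
      obtain ⟨a, rfl⟩ := c.cls_surjective x
      obtain ⟨b, rfl⟩ := c.cls_surjective y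
      obtain ⟨d, rfl⟩ := c.cls_surjective z
      simp only [← cls_sup, sup_assoc])
    (by
      intro x y
      obtain ⟨a, rfl⟩ := c.cls_surjective x
      obtain ⟨b, rfl⟩ := c.cls_surjective y
      rw [← cls_inf, ← cls_inf, inf_comm])
    (by
      intro x y z
      obtain ⟨a, rfl⟩ := c.cls_surjective x
      obtain ⟨b, rfl⟩ := c.cls_surjective y
      obtain ⟨d, rfl⟩ := c.cls_surjective z
      simp only [← cls_inf, inf_assoc])
    (by
      intro x y
      obtain ⟨a, rfl⟩ := c.cls_surjective x
      obtain ⟨b, rfl⟩ := c.cls_surjective y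
      rw [← cls_inf, ← cls_sup, sup_inf_self])
    (by
      intro x y
      obtain ⟨a, rfl⟩ := c.cls_surjective x
      obtain ⟨b, rfl⟩ := c.cls_surjective y
      rw [← cls_sup, ← cls_inf, inf_sup_self])

theorem cls_le {a b : A} : c.cls a ≤ c.cls b ↔ c.r (a ⊔ b) b := by
  rw [← sup_eq_right, ← c.cls_eq, c.cls_sup]
  rfl

theorem cls_mono {a b : A} (h : a ≤ b) : c.cls a ≤ c.cls b := by
  rw [cls_le, sup_eq_right.2 h]

instance : BooleanAlgebra c.Quot where
  __ := DistribLattice.ofInfSupLe (α := c.Quot) (by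
    intro x y z
    obtain ⟨a, rfl⟩ := c.cls_surjective x
    obtain ⟨b, rfl⟩ := c.cls_surjective y
    obtain ⟨d, rfl⟩ := c.cls_surjective z
    exact c.cls_mono (inf_sup_left a b d).le)
  compl := compl
  top := c.cls ⊤
  bot := c.cls ⊥
  inf_compl_le_bot x := by
    obtain ⟨a, rfl⟩ := c.cls_surjective x
    exact c.cls_mono (inf_compl_self a).le
  top_le_sup_compl x := by
    obtain ⟨a, rfl⟩ := c.cls_surjective x
    exact c.cls_mono (sup_compl_eq_top (x := a)).ge
  le_top x := by
    obtain ⟨a, rfl⟩ := c.cls_surjective x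
    exact c.cls_mono le_top
  bot_le x := by
    obtain ⟨a, rfl⟩ := c.cls_surjective x
    exact c.cls_mono bot_le

theorem cls_isLUB {ι : Type u} {f : ι → A} {a : A} (hι : #ι < κ) (ha : IsLUB (Set.range f) a) :
    IsLUB (Set.range fun i => c.cls (f i)) (c.cls a) := by
  constructor
  · rintro _ ⟨i, rfl⟩
    exact c.cls_mono (ha.1 ⟨i, rfl⟩)
  · intro x hx
    obtain ⟨b, rfl⟩ := c.cls_surjective x
    rcases isEmpty_or_nonempty ι with hE | hN
    · exact c.cls_mono (ha.2 (by rintro _ ⟨i, rfl⟩; exact hE.elim i))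
    · rw [cls_le]
      refine c.isLUB' ι (fun i => f i ⊔ b) (fun _ => b) _ _ hι
        (fun i => (c.cls_le).1 (hx ⟨i, rfl⟩)) ?_ ?_
      · constructor
        · rintro _ ⟨i, rfl⟩
          exact sup_le_sup_right (ha.1 ⟨i, rfl⟩) _
        · intro y hy
          refine sup_le (ha.2 ?_) (le_sup_right.trans (hy ⟨hN.some, rfl⟩))
          rintro _ ⟨i, rfl⟩
          exact le_sup_left.trans (hy ⟨i, rfl⟩)
      · simp [Set.range_const, isLUB_singleton]

/-- The quotient `κ`-Boolean algebra of `A` by the congruence `c`. -/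
def quotient : KBool κ where
  carrier := c.Quot
  complete ι f hι := by
    choose g hg using fun i => c.cls_surjective (f i)
    obtain ⟨a, ha⟩ := A.complete ι g hι
    exact ⟨c.cls a, by simpa [hg] using c.cls_isLUB hι ha⟩

/-- The projection of `A` onto its quotient by the congruence `c`. -/
def proj : A ⟶ c.quotient :=
  ({ toFun := c.cls
     map_sup' := c.cls_sup
     map_inf' := c.cls_inf
     map_top' := rfl
     map_bot' := rfl
     map_isLUB' := fun _ _ _ hι ha => c.cls_isLUB hι ha } : Hom A c.quotient)

theorem proj_surjective : Function.Surjective c.proj := c.cls_surjective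

theorem proj_eq {a b : A} : c.proj a = c.proj b ↔ c.r a b := c.cls_eq

/-- The congruence generated by a relation, i.e. the least congruence containing it. -/
def generate (R : Set (A × A)) : Congruence A where
  r a b := ∀ c : Congruence A, (∀ p ∈ R, c.r p.1 p.2) → c.r a b
  iseqv :=
    { refl := fun a c _ => c.refl' a
      symm := fun h c hc => c.symm' (h c hc)
      trans := fun h h' c hc => c.trans' (h c hc) (h' c hc) }
  compl' _ _ h c hc := c.compl' _ _ (h c hc)
  sup' _ _ _ _ h h' c hc := c.sup' _ _ _ _ (h c hc) (h' c hc)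
  isLUB' ι f g a b hι h ha hb c hc := c.isLUB' ι f g a b hι (fun i => h i c hc) ha hb

/-- The kernel of a homomorphism. -/
def ker {A B : KBool κ} (f : A ⟶ B) : Congruence A where
  r a b := f a = f b
  iseqv := ⟨fun _ => rfl, fun h => h.symm, fun h h' => h.trans h'⟩
  compl' a b h := by
    rw [map_compl' (ConcreteCategory.hom f), map_compl' (ConcreteCategory.hom f)]
    exact congrArg compl h
  sup' a a' b b' h h' := by
    rw [map_sup (ConcreteCategory.hom f), map_sup (ConcreteCategory.hom f)]
    exact congrArg₂ (· ⊔ ·) h h'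
  isLUB' ι g g' a b hι h ha hb :=
    ((ConcreteCategory.hom f).map_isLUB hι ha).unique (by
      have := (ConcreteCategory.hom f).map_isLUB hι hb
      rwa [show (fun i => (ConcreteCategory.hom f) (g' i)) = fun i => (ConcreteCategory.hom f) (g i) from
        funext fun i => (h i).symm] at this)

theorem generate_of {R : Set (A × A)} {p : A × A} (hp : p ∈ R) : (generate R).r p.1 p.2 :=
  fun _ hc => hc p hp

end Congruence

/-! ### Free algebras -/

/-- Terms in the operations of `κ`-Boolean algebras, with variables from `X`. The index sets of
`κ`-ary joins run through the subsets of cardinality `< κ` of a fixed set of cardinality `κ`. -/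
inductive Term (κ : Cardinal.{u}) (X : Type u) : Type u
  | var (x : X) : Term κ X
  | bot : Term κ X
  | compl (t : Term κ X) : Term κ X
  | sup (s t : Term κ X) : Term κ X
  | join (I : Set κ.out) (hI : #I < κ) (t : I → Term κ X) : Term κ X

namespace Term

variable {X : Type u}

/-- The value of a term in a `κ`-Boolean algebra. -/
noncomputable def eval (A : KBool κ) (v : X → A) : Term κ X → A
  | var x => v x
  | bot => ⊥
  | compl t => (eval A v t)ᶜ
  | sup s t => eval A v s ⊔ eval A v t
  | join I hI t => (A.complete I (fun i => eval A v (t i)) hI).choose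

theorem eval_join (A : KBool κ) (v : X → A) (I : Set κ.out) (hI : #I < κ) (t : I → Term κ X) :
    IsLUB (Set.range fun i => eval A v (t i)) (eval A v (join I hI t)) := by
  rw [eval]
  exact (A.complete I (fun i => eval A v (t i)) hI).choose_spec

/-- The preorder on terms: `s ≤ t` holds in every `κ`-Boolean algebra. -/
instance : Preorder (Term κ X) where
  le s t := ∀ (A : KBool κ) (v : X → A), eval A v s ≤ eval A v t
  le_refl _ _ _ := le_rfl
  le_trans _ _ _ h h' A v := (h A v).trans (h' A v)

end Term

/-- The carrier of the free `κ`-Boolean algebra on `X`: terms modulo the identities that hold in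
all `κ`-Boolean algebras. -/
def FreeCarrier (κ : Cardinal.{u}) (X : Type u) : Type u := Antisymmetrization (Term κ X) (· ≤ ·)

namespace FreeCarrier

variable {X : Type u}

/-- The class of a term. -/
def cls (t : Term κ X) : FreeCarrier κ X := toAntisymmetrization (· ≤ ·) t

theorem cls_surjective : Function.Surjective (cls (κ := κ) (X := X)) := Quotient.mk_surjective

instance : PartialOrder (FreeCarrier κ X) :=
  inferInstanceAs (PartialOrder (Antisymmetrization (Term κ X) (· ≤ ·)))

theorem cls_le {s t : Term κ X} :
    cls s ≤ cls t ↔ ∀ (A : KBool κ) (v : X → A), s.eval A v ≤ t.eval A v := Iff.rfl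

theorem cls_eq {s t : Term κ X} :
    cls s = cls t ↔ ∀ (A : KBool κ) (v : X → A), s.eval A v = t.eval A v :=
  ⟨fun h A v => le_antisymm (cls_le.1 h.le A v) (cls_le.1 h.ge A v),
    fun h => le_antisymm (cls_le.2 fun A v => (h A v).le) (cls_le.2 fun A v => (h A v).ge)⟩

/-- A term representing an element. -/
noncomputable def rep (x : FreeCarrier κ X) : Term κ X := (cls_surjective x).choose

theorem cls_rep (x : FreeCarrier κ X) : cls x.rep = x := (cls_surjective x).choose_spec

theorem le_iff {x y : FreeCarrier κ X} :
    x ≤ y ↔ ∀ (A : KBool κ) (v : X → A), x.rep.eval A v ≤ y.rep.eval A v := by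
  rw [← cls_le, cls_rep, cls_rep]

theorem rep_cls_eval (t : Term κ X) (A : KBool κ) (v : X → A) :
    (cls t).rep.eval A v = t.eval A v := cls_eq.1 (cls_rep _) A v

noncomputable instance : Max (FreeCarrier κ X) := ⟨fun x y => cls (x.rep.sup y.rep)⟩

noncomputable instance : Min (FreeCarrier κ X) :=
  ⟨fun x y => cls (x.rep.compl.sup y.rep.compl).compl⟩

noncomputable instance : Compl (FreeCarrier κ X) := ⟨fun x => cls x.rep.compl⟩

theorem eval_sup (x y : FreeCarrier κ X) (A : KBool κ) (v : X → A) :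
    (x ⊔ y).rep.eval A v = x.rep.eval A v ⊔ y.rep.eval A v :=
  rep_cls_eval (x.rep.sup y.rep) A v

theorem eval_inf (x y : FreeCarrier κ X) (A : KBool κ) (v : X → A) :
    (x ⊓ y).rep.eval A v = x.rep.eval A v ⊓ y.rep.eval A v :=
  (rep_cls_eval (x.rep.compl.sup y.rep.compl).compl A v).trans (by simp [Term.eval])

theorem eval_compl (x : FreeCarrier κ X) (A : KBool κ) (v : X → A) :
    (xᶜ).rep.eval A v = (x.rep.eval A v)ᶜ :=
  rep_cls_eval x.rep.compl A v

theorem eval_top (A : KBool κ) (v : X → A) :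
    (cls (κ := κ) (X := X) Term.bot.compl).rep.eval A v = ⊤ :=
  (rep_cls_eval Term.bot.compl A v).trans (by simp [Term.eval])

theorem eval_bot (A : KBool κ) (v : X → A) :
    (cls (κ := κ) (X := X) Term.bot).rep.eval A v = ⊥ :=
  rep_cls_eval Term.bot A v

noncomputable instance : BooleanAlgebra (FreeCarrier κ X) where
  sup x y := x ⊔ y
  inf x y := x ⊓ y
  compl := compl
  top := cls Term.bot.compl
  bot := cls Term.bot
  le_sup_left x y := le_iff.2 fun A v => (eval_sup x y A v).symm ▸ le_sup_left
  le_sup_right x y := le_iff.2 fun A v => (eval_sup x y A v).symm ▸ le_sup_right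
  sup_le x y z h h' := le_iff.2 fun A v =>
    (eval_sup x y A v).symm ▸ sup_le (le_iff.1 h A v) (le_iff.1 h' A v)
  inf_le_left x y := le_iff.2 fun A v => (eval_inf x y A v).symm ▸ inf_le_left
  inf_le_right x y := le_iff.2 fun A v => (eval_inf x y A v).symm ▸ inf_le_right
  le_inf x y z h h' := le_iff.2 fun A v =>
    (eval_inf y z A v).symm ▸ le_inf (le_iff.1 h A v) (le_iff.1 h' A v)
  le_sup_inf x y z := le_iff.2 fun A v => by
    have h₁ := eval_inf (x ⊔ y) (x ⊔ z) A v
    have h₂ := eval_sup x (y ⊓ z) A v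
    rw [eval_sup, eval_sup] at h₁
    rw [eval_inf] at h₂
    exact h₁.trans_le (le_sup_inf.trans h₂.ge)
  inf_compl_le_bot x := le_iff.2 fun A v => by
    have h₁ := eval_inf x xᶜ A v
    rw [eval_compl, inf_compl_self] at h₁
    exact h₁.trans_le bot_le
  top_le_sup_compl x := le_iff.2 fun A v => by
    have h₁ := eval_sup x xᶜ A v
    rw [eval_compl, sup_compl_eq_top] at h₁
    exact le_top.trans h₁.ge
  le_top x := le_iff.2 fun A v => le_top.trans (eval_top A v).ge
  bot_le x := le_iff.2 fun A v => (eval_bot A v).trans_le bot_le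

theorem cls_sup (s t : Term κ X) : cls (s.sup t) = cls s ⊔ cls t :=
  cls_eq.2 fun A v => by simp [Term.eval, rep_cls_eval]

theorem cls_compl (t : Term κ X) : cls t.compl = (cls t)ᶜ :=
  cls_eq.2 fun A v => by simp [Term.eval, rep_cls_eval]

theorem cls_join (I : Set κ.out) (hI : #I < κ) (t : I → Term κ X) :
    IsLUB (Set.range fun i => cls (t i)) (cls (Term.join I hI t)) := by
  constructor
  · rintro _ ⟨i, rfl⟩
    exact cls_le.2 fun A v => (Term.eval_join A v I hI t).1 ⟨i, rfl⟩
  · intro x hx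
    obtain ⟨s, rfl⟩ := cls_surjective x
    refine cls_le.2 fun A v => (Term.eval_join A v I hI t).2 ?_
    rintro _ ⟨i, rfl⟩
    exact cls_le.1 (hx ⟨i, rfl⟩) A v

end FreeCarrier

/-- Every index type of cardinality `< κ` is in bijection with one of the index sets that are used
in terms. -/
theorem exists_index {ι : Type u} (hι : #ι < κ) :
    ∃ I : Set κ.out, #I < κ ∧ Nonempty (ι ≃ I) := by
  have h : #ι ≤ #κ.out := by rw [mk_out]; exact hι.le
  obtain ⟨e⟩ := h
  exact ⟨Set.range e, by rwa [mk_range_eq e e.injective], ⟨Equiv.ofInjective e e.injective⟩⟩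

/-- The free `κ`-Boolean algebra on the set `X`. -/
noncomputable def free (κ : Cardinal.{u}) (X : Type u) : KBool κ where
  carrier := FreeCarrier κ X
  complete ι f hι := by
    obtain ⟨I, hI, ⟨e⟩⟩ := exists_index hι
    refine ⟨FreeCarrier.cls (Term.join I hI fun i => (f (e.symm i)).rep), ?_⟩
    · have := FreeCarrier.cls_join I hI fun i => (f (e.symm i)).rep
      simp only [FreeCarrier.cls_rep] at this
      rwa [show (fun i => f (e.symm i)) = f ∘ e.symm from rfl, e.symm.surjective.range_comp] at this

/-- The generators of the free algebra. -/
def gen {X : Type u} (x : X) : free κ X := FreeCarrier.cls (Term.var x)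

/-- The homomorphism from the free algebra that extends a given map on the generators. -/
noncomputable def lift {X : Type u} (A : KBool κ) (v : X → A) : free κ X ⟶ A :=
  ({ toFun := fun x => (FreeCarrier.rep x).eval A v
     map_sup' := fun x y => FreeCarrier.eval_sup x y A v
     map_inf' := fun x y => FreeCarrier.eval_inf x y A v
     map_top' := FreeCarrier.eval_top A v
     map_bot' := FreeCarrier.eval_bot A v
     map_isLUB' := fun ι (f : ι → FreeCarrier κ X) (a : FreeCarrier κ X) hι ha => by
      obtain ⟨I, hI, ⟨e⟩⟩ := exists_index hι
      have h₁ := FreeCarrier.cls_join I hI fun i => (FreeCarrier.rep (f (e.symm i)))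
      have h₂ := Term.eval_join A v I hI fun i => (FreeCarrier.rep (f (e.symm i)))
      simp only [FreeCarrier.cls_rep] at h₁
      have h₃ : Set.range (fun i => f (e.symm i)) = Set.range f :=
        e.symm.surjective.range_comp f
      have h₄ : Set.range (fun i => (FreeCarrier.rep (f (e.symm i))).eval A v) =
          Set.range fun i => (FreeCarrier.rep (f i)).eval A v :=
        e.symm.surjective.range_comp fun i => (FreeCarrier.rep (f i)).eval A v
      have h₅ := h₁.unique (h₃ ▸ ha)
      rw [h₄] at h₂
      have h₆ := FreeCarrier.rep_cls_eval
        (Term.join I hI fun i => (FreeCarrier.rep (f (e.symm i)))) A v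
      rw [h₅] at h₆
      rw [← h₆] at h₂
      exact h₂ } : Hom (free κ X) A)

theorem lift_gen {X : Type u} (A : KBool κ) (v : X → A) (x : X) : lift A v (gen x) = v x :=
  FreeCarrier.rep_cls_eval (Term.var x) A v

theorem free_hom_ext {X : Type u} {A : KBool κ} {f g : free κ X ⟶ A}
    (h : ∀ x : X, f (gen x) = g (gen x)) (x : free κ X) : f x = g x := by
  obtain ⟨t, rfl⟩ := FreeCarrier.cls_surjective x
  induction t with
  | var x => exact h x
  | bot => exact (map_bot (ConcreteCategory.hom f)).trans (map_bot (ConcreteCategory.hom g)).symm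
  | compl t ih =>
    rw [FreeCarrier.cls_compl]
    exact (map_compl' (ConcreteCategory.hom f) _).trans
      ((congrArg compl ih).trans (map_compl' (ConcreteCategory.hom g) _).symm)
  | sup s t ih ih' =>
    rw [FreeCarrier.cls_sup]
    exact (hom_sup f (FreeCarrier.cls s) (FreeCarrier.cls t)).trans
      ((congrArg₂ (· ⊔ ·) ih ih').trans (hom_sup g (FreeCarrier.cls s) (FreeCarrier.cls t)).symm)
  | join I hI t ih =>
    have h₁ := (ConcreteCategory.hom f).map_isLUB hI (FreeCarrier.cls_join I hI t)
    have h₂ := (ConcreteCategory.hom g).map_isLUB hI (FreeCarrier.cls_join I hI t)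
    have h₃ : (fun i => (ConcreteCategory.hom f) (FreeCarrier.cls (t i))) =
      fun i => (ConcreteCategory.hom g) (FreeCarrier.cls (t i)) := funext ih
    rw [h₃] at h₁
    exact h₁.unique h₂

/-! ### Presented algebras -/

/-- A partially ordered set is (the underlying order of) a `κ`-presented `κ`-Boolean algebra if it
is isomorphic to the quotient of a free `κ`-Boolean algebra on fewer than `κ` generators by a
congruence generated by fewer than `κ` pairs. (Order isomorphisms between `κ`-Boolean algebras are
the same as isomorphisms of `κ`-Boolean algebras.) -/
def IsPresented (κ : Cardinal.{u}) (P : Type v) [PartialOrder P] : Prop :=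
  ∃ (X : Type u) (R : Set (free κ X × free κ X)), #X < κ ∧ #R < κ ∧
    Nonempty (P ≃o (Congruence.generate R).quotient)

end KBool

/-- The full subcategory of `KBool κ` of the `κ`-presented `κ`-Boolean algebras. -/
abbrev KBoolPres (κ : Cardinal.{u}) : Type (u + 1) :=
  ObjectProperty.FullSubcategory fun A : KBool κ => KBool.IsPresented κ A

namespace KBool

variable {κ : Cardinal.{u}}

/-- The congruence on `A` generated by the single pair `(⊤, a)`. -/
def elemCongruence (A : KBool κ) (a : A) : Congruence A := Congruence.generate {(⊤, a)}

/-- The homomorphism induced on a quotient by a homomorphism that identifies congruent elements. -/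
noncomputable def factor {A B C : KBool κ} (p : A ⟶ B) (hp : Function.Surjective p) (f : A ⟶ C)
    (h : ∀ x y, p x = p y → f x = f y) : B ⟶ C :=
  have key : ∀ x, f (Function.surjInv hp (p x)) = f x :=
    fun x => h _ _ (Function.surjInv_eq hp _)
  ({ toFun := fun b => f (Function.surjInv hp b)
     map_sup' := fun b b' => by
      obtain ⟨a, rfl⟩ := hp b
      obtain ⟨a', rfl⟩ := hp b'
      have : p a ⊔ p a' = p (a ⊔ a') := (map_sup (ConcreteCategory.hom p) a a').symm
      rw [this, key, key, key]
      exact map_sup (ConcreteCategory.hom f) a a'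
     map_inf' := fun b b' => by
      obtain ⟨a, rfl⟩ := hp b
      obtain ⟨a', rfl⟩ := hp b'
      have : p a ⊓ p a' = p (a ⊓ a') := (map_inf (ConcreteCategory.hom p) a a').symm
      rw [this, key, key, key]
      exact map_inf (ConcreteCategory.hom f) a a'
     map_top' := by
      have : (⊤ : B) = p ⊤ := (map_top (ConcreteCategory.hom p)).symm
      rw [this, key]
      exact map_top (ConcreteCategory.hom f)
     map_bot' := by
      have : (⊥ : B) = p ⊥ := (map_bot (ConcreteCategory.hom p)).symm
      rw [this, key]
      exact map_bot (ConcreteCategory.hom f)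
     map_isLUB' := fun ι g b hι hb => by
      obtain ⟨a, ha⟩ := A.complete ι (fun i => Function.surjInv hp (g i)) hι
      have h₁ := (ConcreteCategory.hom p).map_isLUB hι ha
      have h₂ : (fun i => (ConcreteCategory.hom p) (Function.surjInv hp (g i))) = g :=
        funext fun i => Function.surjInv_eq hp (g i)
      rw [h₂] at h₁
      obtain rfl : b = p a := hb.unique h₁
      rw [key]
      exact (ConcreteCategory.hom f).map_isLUB hι ha } : Hom B C)

theorem factor_apply {A B C : KBool κ} (p : A ⟶ B) (hp : Function.Surjective p) (f : A ⟶ C)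
    (h : ∀ x y, p x = p y → f x = f y) (x : A) : factor p hp f h (p x) = f x :=
  h _ _ (Function.surjInv_eq hp _)

/-- Two quotients of `A` with the same kernel are isomorphic. -/
theorem orderIso_of_ker {A B C : KBool κ} (p : A ⟶ B) (hp : Function.Surjective p) (q : A ⟶ C)
    (hq : Function.Surjective q) (h : ∀ x y, p x = p y ↔ q x = q y) : Nonempty (B ≃o C) := by
  let f := factor p hp q fun x y => (h x y).1
  let g := factor q hq p fun x y => (h x y).2
  have hf : Monotone f := OrderHomClass.mono (ConcreteCategory.hom f)
  have hg : Monotone g := OrderHomClass.mono (ConcreteCategory.hom g)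
  have hgf : ∀ b, g (f b) = b := fun b => by
    obtain ⟨a, rfl⟩ := hp b
    simp only [f, g, factor_apply]
  have hfg : ∀ c, f (g c) = c := fun c => by
    obtain ⟨a, rfl⟩ := hq c
    simp only [f, g, factor_apply]
  exact ⟨{ toFun := f, invFun := g, left_inv := hgf, right_inv := hfg
           map_rel_iff' := fun {x y} =>
            ⟨fun hxy => by simpa only [hgf] using hg (show f x ≤ f y from hxy), fun hxy => hf hxy⟩ }⟩

/-- An order isomorphism of `κ`-Boolean algebras, as a homomorphism. -/
def ofOrderIso {A B : KBool κ} (e : A ≃o B) : A ⟶ B :=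
  ({ toFun := e
     map_sup' := e.map_sup
     map_inf' := e.map_inf
     map_top' := e.map_top
     map_bot' := e.map_bot
     map_isLUB' := fun ι f a _ ha => by
      have := (e.isLUB_image' (s := Set.range f) (x := a)).2 ha
      rwa [← Set.range_comp] at this } : Hom A B)

/-- The quotient of a `κ`-presented algebra by a pair `(⊤, a)` is `κ`-presented. -/
theorem isPresented_quotient (hκ : κ.IsRegular) {A : KBool κ} (hA : IsPresented κ A) (a : A) :
    IsPresented κ (elemCongruence A a).quotient := by
  obtain ⟨X, R, hX, hR, ⟨e⟩⟩ := hA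
  let p : free κ X ⟶ A := (Congruence.generate R).proj ≫ ofOrderIso e.symm
  have hp : Function.Surjective p := e.symm.surjective.comp (Congruence.proj_surjective _)
  have hker : ∀ x y, p x = p y ↔ (Congruence.generate R).r x y := fun x y =>
    (e.symm.injective.eq_iff).trans (Congruence.proj_eq _)
  obtain ⟨s, hs⟩ := hp a
  have hR' : #(insert (⊤, s) R : Set (free κ X × free κ X)) < κ :=
    (mk_insert_le).trans_lt (add_lt_of_lt hκ.aleph0_le hR (one_lt_aleph0.trans_le hκ.aleph0_le))
  refine ⟨X, insert (⊤, s) R, hX, hR', ?_⟩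
  let q := (Congruence.generate (insert (⊤, s) R)).proj
  have hq : Function.Surjective q := Congruence.proj_surjective _
  let p' : free κ X ⟶ (elemCongruence A a).quotient := p ≫ (elemCongruence A a).proj
  have hp' : Function.Surjective p' := (Congruence.proj_surjective _).comp hp
  have htop : p ⊤ = ⊤ := map_top (ConcreteCategory.hom p)
  refine orderIso_of_ker p' hp' q hq fun x y => ?_
  constructor
  · intro h
    have hpq : ∀ x y, p x = p y → q x = q y := fun x y hxy =>
      (Congruence.proj_eq _).2 fun c hc =>
        (hker x y).1 hxy c fun r hr => hc r (Set.mem_insert_of_mem _ hr)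
    let f := factor p hp q hpq
    have hf : ∀ x, f (p x) = q x := factor_apply p hp q hpq
    have h₁ := (Congruence.proj_eq _).1 h (Congruence.ker f) (by
      rintro _ rfl
      change f ⊤ = f a
      rw [← htop, ← hs, hf, hf]
      exact (Congruence.proj_eq _).2 (Congruence.generate_of (Set.mem_insert (⊤, s) R)))
    have h₂ : f (p x) = f (p y) := h₁
    rwa [hf, hf] at h₂
  · intro h
    refine (Congruence.proj_eq _).1 h (Congruence.ker p') ?_
    rintro r (rfl | hr)
    · change (elemCongruence A a).proj (p ⊤) = (elemCongruence A a).proj (p s)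
      rw [htop, hs]
      exact (Congruence.proj_eq _).2 (Congruence.generate_of (Set.mem_singleton (⊤, a)))
    · exact congrArg (elemCongruence A a).proj
        ((hker r.1 r.2).2 (Congruence.generate_of hr))

end KBool

namespace KBoolPres

variable {κ : Cardinal.{u}}

/-- The quotient `A / a` of a `κ`-presented algebra by the congruence generated by `(⊤, a)`. -/
def quot (hκ : κ.IsRegular) (A : KBoolPres κ) (a : A.obj) : KBoolPres κ :=
  ⟨(KBool.elemCongruence A.obj a).quotient, KBool.isPresented_quotient hκ A.property a⟩

/-- The projection `A ⟶ A / a`. -/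
def quotProj (hκ : κ.IsRegular) (A : KBoolPres κ) (a : A.obj) : A ⟶ quot hκ A a :=
  ObjectProperty.homMk (KBool.elemCongruence A.obj a).proj

instance (hκ : κ.IsRegular) (A : KBoolPres κ) (a : A.obj) : Epi (quotProj hκ A a) where
  left_cancellation g h hgh := by
    apply ObjectProperty.hom_ext
    apply ConcreteCategory.hom_ext
    intro x
    obtain ⟨y, rfl⟩ := (KBool.elemCongruence A.obj a).proj_surjective x
    exact ConcreteCategory.congr_hom (congrArg (fun k => k.hom) hgh) y

end KBoolPres

namespace KBool

variable {κ : Cardinal.{u}}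

/-! For (1), let `b : B` lie outside the image of `f : A ⟶ B`. Two homomorphisms out of `B` that
agree on the image but differ at `b` are built by forcing. A condition is a pair `(x, y)` of
elements of `B` that no `f a` separates, to be thought of as a nonzero `x ⊗ y` in the amalgam of two
copies of `B` over `A`. The regular lower sets of conditions form a complete Boolean algebra, and
the two homomorphisms send `z` to the regular lower sets generated by `x ≤ z` and by `y ≤ z`. They
preserve joins of fewer than `κ` elements because separators of fewer than `κ` pieces of `x` can be
joined in `A` (`Unseparated.exists_le_of_isLUB`). They agree on the image because a condition with
`x ≤ f a` can be refined to one with `y ≤ f a`. They differ at `b` because `(b, bᶜ)` is a condition.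

For (2), a pushout of `κ`-presented algebras is again `κ`-presented, so an epimorphism of the
subcategory is one in `KBool κ`, hence surjective by (1). A subobject of `A` in the opposite
category is therefore a quotient of `A`. Its kernel is generated by fewer than `κ` equations. Each
equation `x = y` says that `x ⇔ y` is `⊤`, so the meet `a` of these elements presents the quotient
as `A / a` (`exists_ker_eq_elemCongruence`). Since `A / a` is the universal quotient making `a`
equal to `⊤`, its pushout along `f` is `B / f a`, which is naturality. The claims about subobject
posets are then transported from `A` and `f`. -/

/-- A map preserving the top element, binary meets and joins of families of fewer than `κ` elements
is a homomorphism. -/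
def homOfIsLUB (hκ : ℵ₀ ≤ κ) {A B : KBool κ} (h : A → B) (htop : h ⊤ = ⊤)
    (hinf : ∀ x y, h (x ⊓ y) = h x ⊓ h y)
    (hlub : ∀ (ι : Type u) (f : ι → A) (a : A), #ι < κ → IsLUB (Set.range f) a →
      IsLUB (Set.range fun i => h (f i)) (h a)) : A ⟶ B :=
  ({ toFun := h
     map_sup' := fun x y => by
      -- Finite joins are covered by `hlub`: a binary join is a join over a two-element type, and
      -- `⊥` is the empty join.
      have h₁ := hlub (ULift Bool) (fun i => bif i.down then x else y) (x ⊔ y)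
        ((lt_aleph0_of_finite _).trans_le hκ) (by
          constructor
          · rintro _ ⟨⟨_ | _⟩, rfl⟩ <;> simp
          · intro z hz
            exact sup_le (hz ⟨⟨true⟩, rfl⟩) (hz ⟨⟨false⟩, rfl⟩))
      apply le_antisymm
      · apply h₁.2
        rintro _ ⟨⟨_ | _⟩, rfl⟩
        · exact le_sup_right
        · exact le_sup_left
      · exact sup_le (h₁.1 ⟨⟨true⟩, rfl⟩) (h₁.1 ⟨⟨false⟩, rfl⟩)
     map_inf' := hinf
     map_top' := htop
     map_bot' := by
      have h₁ := hlub PEmpty (fun i => i.elim) ⊥ ((lt_aleph0_of_finite _).trans_le hκ)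
        (by rw [Set.range_eq_empty]; exact isLUB_empty)
      rw [Set.range_eq_empty, isLUB_empty_iff] at h₁
      exact h₁.eq_bot
     map_isLUB' := hlub } : Hom A B)

/-! ### Amalgamation over the image of a homomorphism -/

variable {A B : KBool κ} (f : A ⟶ B)

/-- The pairs of elements of `B` that cannot be separated by an element of the image of `f`. -/
def Unseparated : Type u :=
  {p : B × B // ∀ a : A, p.1 ≤ f a → ¬ Disjoint (f a) p.2}

instance : Preorder (Unseparated f) := inferInstanceAs
  (Preorder {p : B × B // ∀ a : A, p.1 ≤ f a → ¬ Disjoint (f a) p.2})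

namespace Unseparated

variable {f}

/-- If `f a` separated the swapped pair, then `f aᶜ` would separate the original one, so the
condition is symmetric. -/
theorem swap_property (p : Unseparated f) (a : A) (h : p.1.2 ≤ f a) : ¬ Disjoint (f a) p.1.1 := by
  intro h'
  refine p.2 aᶜ ?_ ?_
  · rw [map_compl' (ConcreteCategory.hom f)]
    exact h'.symm.le_compl_right
  · rw [map_compl' (ConcreteCategory.hom f)]
    exact disjoint_compl_left.mono_right h

/-- Exchange of the two components. -/
def swap (p : Unseparated f) : Unseparated f := ⟨p.1.swap, p.swap_property⟩

theorem swap_le {p q : Unseparated f} (h : p ≤ q) : p.swap ≤ q.swap := ⟨h.2, h.1⟩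

/-- If the first component of an unseparated pair is covered by fewer than `κ` elements, then it
can be cut down to one of them. -/
theorem exists_le_of_isLUB (p : Unseparated f) {ι : Type u} (hι : #ι < κ) {g : ι → B} {b : B}
    (hb : IsLUB (Set.range g) b) (hp : p.1.1 ≤ b) : ∃ q ≤ p, ∃ i, q.1.1 ≤ g i := by
  by_contra! H
  -- If no piece `(p.1.1 ⊓ g i, p.1.2)` is unseparated, each has a separator `f (a i)`; the image of
  -- the join of the `a i` then separates `p` itself.
  have H' : ∀ i, ∃ a : A, p.1.1 ⊓ g i ≤ f a ∧ Disjoint (f a) p.1.2 := by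
    intro i
    by_contra! h
    exact H ⟨(p.1.1 ⊓ g i, p.1.2), h⟩ ⟨inf_le_left, le_rfl⟩ i inf_le_right
  choose a ha hd using H'
  obtain ⟨s, hs⟩ := A.complete ι a hι
  have hfs := (ConcreteCategory.hom f).map_isLUB hι hs
  refine p.2 s ?_ ?_
  · have : b ≤ p.1.1ᶜ ⊔ f s := hb.2 <| by
      rintro _ ⟨i, rfl⟩
      rw [sup_comm, ← himp_eq, le_himp_iff, inf_comm]
      exact (ha i).trans (hfs.1 ⟨i, rfl⟩)
    have h := hp.trans this
    rw [sup_comm, ← himp_eq, le_himp_iff, inf_idem] at h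
    exact h
  · refine le_compl_iff_disjoint_right.1 (hfs.2 ?_)
    rintro _ ⟨i, rfl⟩
    exact (hd i).le_compl_right

/-- The second component of an unseparated pair can be cut down to an element of the image of `f`
that lies above the first one. -/
theorem exists_le_of_le (p : Unseparated f) (a : A) (hp : p.1.1 ≤ f a) :
    ∃ q ≤ p, q.1.2 ≤ f a := by
  -- A separator `a'` of the refined pair would make `a' ⊓ a` a separator of `p`, since `p.1.1 ≤ f
  -- a`.
  refine ⟨⟨(p.1.1, p.1.2 ⊓ f a), fun a' h h' => p.2 (a' ⊓ a) ?_ ?_⟩, ⟨le_rfl, inf_le_left⟩,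
    inf_le_right⟩
  · rw [map_inf (ConcreteCategory.hom f)]
    exact le_inf h hp
  · rw [map_inf (ConcreteCategory.hom f), disjoint_assoc, inf_comm]
    exact h'

end Unseparated

/-! ### Regular lower sets of a preorder as a complete Boolean algebra. -/

section RegularLowerSet

open Heyting.Regular (toRegular)

variable {P : Type u} [Preorder P]

/-- The density criterion of forcing: an element of `U` with an extension in `V` cannot lie in the
lower set `Vᶜ`. All later comparisons of regular lower sets reduce to it. -/
theorem toRegular_le_toRegular {U V : LowerSet P} (h : ∀ p ∈ U, ∃ q ≤ p, q ∈ V) :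
    toRegular U ≤ toRegular V := by
  refine (Heyting.Regular.gi.gc U (toRegular V)).2 ?_
  change U ≤ Vᶜᶜ
  rw [le_compl_iff_disjoint_right, disjoint_iff_inf_le]
  rintro p ⟨hU, hV⟩
  obtain ⟨q, hq, hqV⟩ := h p hU
  have : q ∈ V ⊓ Vᶜ := ⟨hqV, (Vᶜ).lower hq hV⟩
  rwa [inf_compl_self] at this

/-- The regular lower sets of a preordered set. -/
def regularLowerSets (κ : Cardinal.{u}) (P : Type u) [Preorder P] : KBool κ where
  carrier := Heyting.Regular (LowerSet P)
  complete ι f _ := ⟨toRegular (⨆ i, (f i : LowerSet P)), by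
    -- `toRegular` is left adjoint to the inclusion, so it carries the union of the lower sets to a
    -- join.
    have h := Heyting.Regular.gi.gc.isLUB_l_image
      (isLUB_iSup (f := fun i => (f i : LowerSet P)))
    rw [← Set.range_comp] at h
    simpa [Function.comp_def] using h⟩

/-- The lower set of the elements of `P` that are mapped below `b`. -/
def lowerSetBelow (π : P →o B) (b : B) : LowerSet P :=
  ⟨{p | π p ≤ b}, fun _ _ h hp => (π.monotone h).trans hp⟩

theorem mem_lowerSetBelow {π : P →o B} {b : B} {p : P} : p ∈ lowerSetBelow π b ↔ π p ≤ b := Iff.rfl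

/-- The homomorphism into the algebra of regular lower sets induced by a monotone map along which
covers by fewer than `κ` elements can be refined. -/
def toRegularLowerSets (hκ : ℵ₀ ≤ κ) (π : P →o B)
    (hπ : ∀ (ι : Type u) (g : ι → B) (b : B) (p : P), #ι < κ → IsLUB (Set.range g) b → π p ≤ b →
      ∃ q ≤ p, ∃ i, π q ≤ g i) : B ⟶ regularLowerSets κ P :=
  homOfIsLUB hκ (B := regularLowerSets κ P) (fun b => toRegular (lowerSetBelow π b))
    (top_le_iff.1 <| (Heyting.Regular.toRegular_coe (⊤ : Heyting.Regular (LowerSet P))).symm.trans_le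
      (toRegular_le_toRegular fun p _ => ⟨p, le_rfl, mem_lowerSetBelow.2 le_top⟩))
    (fun x y => by
      have h : lowerSetBelow π (x ⊓ y) = lowerSetBelow π x ⊓ lowerSetBelow π y := by
        ext p
        exact le_inf_iff
      apply Heyting.Regular.coe_injective
      change (lowerSetBelow π (x ⊓ y))ᶜᶜ = (lowerSetBelow π x)ᶜᶜ ⊓ (lowerSetBelow π y)ᶜᶜ
      rw [h, compl_compl_inf_distrib])
    (by
      intro ι g b hι hb
      constructor
      · rintro _ ⟨i, rfl⟩
        exact toRegular_le_toRegular fun p hp => ⟨p, le_rfl, le_trans hp (hb.1 ⟨i, rfl⟩)⟩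
      · intro R hR
        have hR' : ∀ i, lowerSetBelow π (g i) ≤ Heyting.Regular.val R := fun i =>
          (Heyting.Regular.gi.gc _ _).1 (hR ⟨i, rfl⟩)
        -- An upper bound `R` is regular, so it equals its own regularization and the density
        -- criterion applies.
        rw [← Heyting.Regular.toRegular_coe (α := LowerSet P) R]
        refine toRegular_le_toRegular fun p hp => ?_
        obtain ⟨q, hq, i, hi⟩ := hπ ι g b p hι hb hp
        exact ⟨q, hq, hR' i hi⟩)

end RegularLowerSet

-- The two coordinate projections from unseparated pairs to `B` induce the two homomorphisms;
-- properties of the second projection follow from those of the first by `swap`.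
variable {f} in
theorem exists_hom_ne (hκ : ℵ₀ ≤ κ) {b : B} (hb : ∀ a, f a ≠ b) :
    ∃ (E : KBool κ) (g h : B ⟶ E), f ≫ g = f ≫ h ∧ g b ≠ h b := by
  let π₁ : Unseparated f →o B := ⟨fun p => p.1.1, fun _ _ h => h.1⟩
  let π₂ : Unseparated f →o B := ⟨fun p => p.1.2, fun _ _ h => h.2⟩
  have h₁ := fun (ι : Type u) (g : ι → B) (b : B) (p : Unseparated f) (hι : #ι < κ)
    (hb : IsLUB (Set.range g) b) (hp : π₁ p ≤ b) => p.exists_le_of_isLUB hι hb hp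
  have h₂ : ∀ (ι : Type u) (g : ι → B) (b : B) (p : Unseparated f), #ι < κ →
      IsLUB (Set.range g) b → π₂ p ≤ b → ∃ q ≤ p, ∃ i, π₂ q ≤ g i := by
    intro ι g b p hι hb hp
    obtain ⟨q, hq, i, hi⟩ := p.swap.exists_le_of_isLUB hι hb hp
    exact ⟨q.swap, Unseparated.swap_le hq, i, hi⟩
  refine ⟨_, toRegularLowerSets hκ π₁ h₁, toRegularLowerSets hκ π₂ h₂, ?_, fun h => ?_⟩
  · apply ConcreteCategory.hom_ext
    intro a
    apply le_antisymm
    · exact toRegular_le_toRegular fun p hp => p.exists_le_of_le a hp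
    · refine toRegular_le_toRegular fun p hp => ?_
      obtain ⟨q, hq, hqa⟩ := p.swap.exists_le_of_le a hp
      exact ⟨q.swap, Unseparated.swap_le hq, hqa⟩
  -- A separator of `(b, bᶜ)` would satisfy `b ≤ f a ≤ b`. The pair lies in the first value at `b`;
  -- no condition below it has second component below `b`, so it is not in the second.
  · let p : Unseparated f := ⟨(b, bᶜ), fun a h h' =>
      hb a (le_antisymm (by simpa using h'.le_compl_right) h)⟩
    have hp : p ∈ (lowerSetBelow π₂ b)ᶜᶜ := by
      have h' : (lowerSetBelow π₁ b)ᶜᶜ = (lowerSetBelow π₂ b)ᶜᶜ :=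
        congrArg Heyting.Regular.val h
      rw [← h']
      exact le_compl_compl (a := lowerSetBelow π₁ b) (show p ∈ lowerSetBelow π₁ b from le_rfl)
    have hp' : LowerSet.Iic p ≤ (lowerSetBelow π₂ b)ᶜ := by
      rw [le_compl_iff_disjoint_right, disjoint_iff_inf_le]
      rintro q ⟨hq, hqb⟩
      have h₁ : q.1.2 ≤ bᶜ := (show q ≤ p from hq).2
      have h₂ : q.1.2 ≤ ⊥ := (le_inf h₁ hqb).trans (compl_inf_self b).le
      refine q.swap_property ⊥ (h₂.trans bot_le) ?_
      rw [map_bot (ConcreteCategory.hom f)]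
      exact disjoint_bot_left
    have : p ∈ (lowerSetBelow π₂ b)ᶜ ⊓ (lowerSetBelow π₂ b)ᶜᶜ := ⟨hp' (LowerSet.mem_Iic_iff.2 le_rfl), hp⟩
    rwa [inf_compl_self] at this

/-- Every epimorphism of `κ`-Boolean algebras is surjective. -/
theorem surjective_of_epi (hκ : ℵ₀ ≤ κ) [Epi f] : Function.Surjective f := by
  by_contra h
  simp only [Function.Surjective, not_forall, not_exists] at h
  obtain ⟨b, hb⟩ := h
  obtain ⟨E, g, h, hgh, hne⟩ := exists_hom_ne hκ hb
  exact hne (ConcreteCategory.congr_hom ((cancel_epi f).1 hgh) b)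

end KBool

namespace KBool

variable {κ : Cardinal.{u}}

/-! ### Quotients by a principal filter -/

/-- The congruence that identifies two elements with the same meet with `a`. -/
def infCongruence (A : KBool κ) (a : A) : Congruence A where
  r x y := a ⊓ x = a ⊓ y
  iseqv := ⟨fun _ => rfl, fun h => h.symm, fun h h' => h.trans h'⟩
  compl' x y h := by
    have key : ∀ z : A, a ⊓ zᶜ = a \ (a ⊓ z) := fun z => by
      rw [sdiff_inf_self_left, sdiff_eq]
    rw [key, key, h]
  sup' x x' y y' h h' := by rw [inf_sup_left, inf_sup_left, h, h']
  isLUB' ι f g x y _ h hx hy := by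
    have key : ∀ (f g : ι → A) (x y : A), (∀ i, a ⊓ f i = a ⊓ g i) → IsLUB (Set.range f) x →
        IsLUB (Set.range g) y → a ⊓ x ≤ a ⊓ y := by
      intro f g x y h hx hy
      refine le_inf inf_le_left ?_
      -- Meeting with `a` is left adjoint to `a ⇨ ·`, so it respects every existing join.
      rw [inf_comm, ← le_himp_iff]
      refine hx.2 ?_
      rintro _ ⟨i, rfl⟩
      rw [le_himp_iff, inf_comm, h]
      exact inf_le_right.trans (hy.1 ⟨i, rfl⟩)
    exact le_antisymm (key f g x y h hx hy) (key g f y x (fun i => (h i).symm) hy hx)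

/-- Having equal meets with `a` is a congruence containing `(⊤, a)`. Conversely, any congruence
containing that pair relates `z = ⊤ ⊓ z` to `a ⊓ z`. -/
theorem elemCongruence_r {A : KBool κ} {a x y : A} :
    (elemCongruence A a).r x y ↔ a ⊓ x = a ⊓ y := by
  constructor
  · intro h
    refine h (infCongruence A a) ?_
    rintro _ rfl
    change a ⊓ ⊤ = a ⊓ a
    simp
  · intro h
    have key : ∀ z : A, (elemCongruence A a).r z (a ⊓ z) := fun z => by
      have := (elemCongruence A a).inf' ⊤ a z z
        (Congruence.generate_of (Set.mem_singleton (⊤, a))) ((elemCongruence A a).refl' z)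
      rwa [top_inf_eq] at this
    have h₁ := key x
    rw [h] at h₁
    exact (elemCongruence A a).trans' h₁ ((elemCongruence A a).symm' (key y))

theorem elemCongruence_proj_eq {A : KBool κ} {a x y : A} :
    (elemCongruence A a).proj x = (elemCongruence A a).proj y ↔ a ⊓ x = a ⊓ y :=
  (Congruence.proj_eq _).trans elemCongruence_r

theorem elemCongruence_proj_eq_top {A : KBool κ} {a x : A} :
    (elemCongruence A a).proj x = ⊤ ↔ a ≤ x := by
  rw [← map_top (ConcreteCategory.hom (elemCongruence A a).proj), elemCongruence_proj_eq,
    inf_top_eq, inf_eq_left]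

theorem elemCongruence_proj_self {A : KBool κ} (a : A) : (elemCongruence A a).proj a = ⊤ :=
  elemCongruence_proj_eq_top.2 le_rfl

/-- An equation becomes the condition that one element goes to `⊤`; meets then merge fewer than `κ`
equations into a single one. -/
theorem hom_eq_iff_bihimp {A B : KBool κ} (f : A ⟶ B) (x y : A) :
    f x = f y ↔ f (bihimp x y) = ⊤ := by
  rw [map_bihimp (ConcreteCategory.hom f), bihimp_eq_top]

/-- A homomorphism that sends `a` to the top element factors through `A / a`. -/
theorem exists_elemCongruence_proj_comp_eq {A B : KBool κ} (f : A ⟶ B) {a : A} (ha : f a = ⊤) :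
    ∃ g : (elemCongruence A a).quotient ⟶ B, (elemCongruence A a).proj ≫ g = f := by
  have hs := (elemCongruence A a).proj_surjective
  have hf : ∀ x y, (elemCongruence A a).proj x = (elemCongruence A a).proj y → f x = f y := by
    intro x y h
    have := congrArg f (elemCongruence_proj_eq.1 h)
    rwa [map_inf (ConcreteCategory.hom f), map_inf (ConcreteCategory.hom f), ha, top_inf_eq,
      top_inf_eq] at this
  exact ⟨factor _ hs f hf, ConcreteCategory.hom_ext _ _ (factor_apply _ hs f hf)⟩

/-- The quotient `A / a` is isomorphic to the principal ideal of `a`. -/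
theorem exists_orderIso_Iic (A : KBool κ) (a : A) :
    ∃ e : (elemCongruence A a).quotient ≃o Set.Iic a,
      ∀ x : A, (e ((elemCongruence A a).proj x) : A) = a ⊓ x := by
  have hs := (elemCongruence A a).proj_surjective
  have hle : ∀ x y : A, (elemCongruence A a).proj x ≤ (elemCongruence A a).proj y ↔
      a ⊓ x ≤ a ⊓ y := fun x y => by
    rw [← inf_eq_left, ← map_inf (ConcreteCategory.hom (elemCongruence A a).proj),
      elemCongruence_proj_eq, ← inf_eq_left (a := a ⊓ x), inf_inf_distrib_left]
  let g : (elemCongruence A a).quotient → Set.Iic a := fun q =>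
    ⟨a ⊓ Function.surjInv hs q, inf_le_left⟩
  have hg : ∀ x, (g ((elemCongruence A a).proj x) : A) = a ⊓ x := fun x =>
    elemCongruence_proj_eq.1 (Function.surjInv_eq hs _)
  let e : (elemCongruence A a).quotient ↪o Set.Iic a := OrderEmbedding.ofMapLEIff g (by
    intro q q'
    obtain ⟨x, rfl⟩ := hs q
    obtain ⟨y, rfl⟩ := hs q'
    rw [← Subtype.coe_le_coe, hg, hg, hle])
  refine ⟨RelIso.ofSurjective e fun y => ⟨(elemCongruence A a).proj y, ?_⟩, hg⟩
  apply Subtype.ext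
  exact (hg y).trans (inf_eq_right.2 y.2)

theorem exists_isGLB (A : KBool κ) {ι : Type u} (f : ι → A) (hι : #ι < κ) :
    ∃ a, IsGLB (Set.range f) a := by
  obtain ⟨a, ha⟩ := A.complete ι (fun i => (f i)ᶜ) hι
  refine ⟨aᶜ, ?_, fun b hb => ?_⟩
  · rintro _ ⟨i, rfl⟩
    exact compl_le_of_compl_le (ha.1 ⟨i, rfl⟩)
  · refine le_compl_comm.1 (ha.2 ?_)
    rintro _ ⟨i, rfl⟩
    exact compl_le_compl (hb ⟨i, rfl⟩)

theorem map_isGLB {A B : KBool κ} (h : A ⟶ B) {ι : Type u} {f : ι → A} {a : A}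
    (hι : #ι < κ) (ha : IsGLB (Set.range f) a) : IsGLB (Set.range fun i => h (f i)) (h a) := by
  have h₁ : IsLUB (Set.range fun i => (f i)ᶜ) aᶜ := by
    constructor
    · rintro _ ⟨i, rfl⟩
      exact compl_le_compl (ha.1 ⟨i, rfl⟩)
    · intro b hb
      refine compl_le_of_compl_le (ha.2 ?_)
      rintro _ ⟨i, rfl⟩
      exact compl_le_of_compl_le (hb ⟨i, rfl⟩)
  have h₂ := (ConcreteCategory.hom h).map_isLUB hι h₁
  simp only [map_compl'] at h₂
  constructor
  · rintro _ ⟨i, rfl⟩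
    exact compl_le_compl_iff_le.1 (h₂.1 ⟨i, rfl⟩)
  · intro b hb
    refine le_compl_comm.1 (h₂.2 ?_) |>.trans (compl_compl _).le
    rintro _ ⟨i, rfl⟩
    exact compl_le_compl (hb ⟨i, rfl⟩)

/-! ### Presentations -/

theorem Congruence.generate_le_ker {A B : KBool κ} {R : Set (A × A)} (f : A ⟶ B)
    (h : ∀ r ∈ R, f r.1 = f r.2) {x y : A} (hxy : (Congruence.generate R).r x y) : f x = f y :=
  hxy (Congruence.ker f) h

theorem IsPresented.exists_presentation {A : KBool κ} (hA : IsPresented κ A) :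
    ∃ (X : Type u) (R : Set (free κ X × free κ X)) (p : free κ X ⟶ A), #X < κ ∧ #R < κ ∧
      Function.Surjective p ∧ ∀ x y, p x = p y ↔ (Congruence.generate R).r x y := by
  obtain ⟨X, R, hX, hR, ⟨e⟩⟩ := hA
  exact ⟨X, R, (Congruence.generate R).proj ≫ ofOrderIso e.symm, hX, hR,
    e.symm.surjective.comp (Congruence.proj_surjective _),
    fun x y => (e.symm.injective.eq_iff).trans (Congruence.proj_eq _)⟩

theorem free_hom_ext' {X : Type u} {A : KBool κ} {f g : free κ X ⟶ A}
    (h : ∀ x : X, f (gen x) = g (gen x)) : f = g :=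
  ConcreteCategory.hom_ext _ _ (free_hom_ext h)

/-- The kernel of a surjective homomorphism between `κ`-presented algebras is generated by a single
pair `(⊤, a)`. -/
theorem exists_ker_eq_elemCongruence (hκ : ℵ₀ ≤ κ) {A B : KBool κ} (hA : IsPresented κ A)
    (hB : IsPresented κ B) (f : A ⟶ B) (hf : Function.Surjective f) :
    ∃ a : A, f a = ⊤ ∧
      ∀ x y, f x = f y → (elemCongruence A a).proj x = (elemCongruence A a).proj y := by
  obtain ⟨X, -, p, hX, -, hp, -⟩ := hA.exists_presentation
  obtain ⟨Y, R, q, -, hR, hq, hqR⟩ := hB.exists_presentation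
  choose t ht using fun y : Y => hf (q (gen y))
  choose s hs using fun x : X => hq (f (p (gen x)))
  -- `σ` lifts the presentation `q` of `B` through `f`. The kernel of `f` is generated by
  -- identifying each generator `p (gen x)` of `A` with its rewriting `σ (s x)`, and by the
  -- relations of `B` transported along `σ`.
  let σ : free κ Y ⟶ A := lift A t
  have hσ : σ ≫ f = q := free_hom_ext' fun y =>
    (congrArg f (lift_gen A t y)).trans (ht y)
  have hσ' : ∀ z, f (σ z) = q z := fun z => ConcreteCategory.congr_hom hσ z
  let g : X ⊕ R → A := Sum.elim (fun x => bihimp (p (gen x)) (σ (s x)))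
    fun r => bihimp (σ r.1.1) (σ r.1.2)
  have hι : #(X ⊕ R) < κ := by
    rw [mk_sum, lift_id, lift_id]
    exact add_lt_of_lt hκ hX hR
  obtain ⟨a, ha⟩ := A.exists_isGLB g hι
  have hfa : f a = ⊤ := by
    refine top_le_iff.1 ((map_isGLB f hι ha).2 ?_)
    rintro _ ⟨x | r, rfl⟩
    · exact ((hom_eq_iff_bihimp f _ _).1 ((hs x).symm.trans (hσ' _).symm)).ge
    · refine ((hom_eq_iff_bihimp f _ _).1 ?_).ge
      rw [hσ', hσ', hqR]
      exact Congruence.generate_of r.2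
  refine ⟨a, hfa, fun x y hxy => ?_⟩
  let π := (elemCongruence A a).proj
  have hπ : ∀ i, π (g i) = ⊤ := fun i => elemCongruence_proj_eq_top.2 (ha.1 ⟨i, rfl⟩)
  -- Modulo `a` the relations of `B` hold, so `σ ≫ π` descends to `h`. The other equations give `f ≫
  -- h = π` on generators, which bounds the kernel of `f` by that of `π`.
  let h : B ⟶ (elemCongruence A a).quotient := factor q hq (σ ≫ π) fun x y hxy =>
    Congruence.generate_le_ker (σ ≫ π)
      (fun r hr => (hom_eq_iff_bihimp π _ _).2 (hπ (.inr ⟨r, hr⟩))) ((hqR x y).1 hxy)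
  have hh : p ≫ f ≫ h = p ≫ π := free_hom_ext' fun x =>
    (congrArg h (hs x)).symm.trans ((factor_apply _ _ _ _ _).trans
      ((hom_eq_iff_bihimp π _ _).2 (hπ (.inl x))).symm)
  have hh' : ∀ x, h (f x) = π x := fun x => by
    obtain ⟨z, rfl⟩ := hp x
    exact ConcreteCategory.congr_hom hh z
  change π x = π y
  rw [← hh', ← hh', hxy]

/-! ### Pushouts -/

theorem isPushout_of_exists_desc {V : Type*} [Category V] {A B C D : V} {f : C ⟶ A} {g : C ⟶ B}
    {i : A ⟶ D} {j : B ⟶ D} (w : f ≫ i = g ≫ j)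
    (desc : ∀ {E : V} (u : A ⟶ E) (v : B ⟶ E), f ≫ u = g ≫ v → ∃ d, i ≫ d = u ∧ j ≫ d = v)
    (ext : ∀ {E : V} (d d' : D ⟶ E), i ≫ d = i ≫ d' → j ≫ d = j ≫ d' → d = d') :
    IsPushout f g i j := by
  choose d hd₁ hd₂ using @desc
  exact ⟨⟨w⟩, ⟨PushoutCocone.IsColimit.mk w (fun s => d s.inl s.inr s.condition)
    (fun s => hd₁ _ _ _) (fun s => hd₂ _ _ _)
    fun s m h₁ h₂ => ext _ _ (h₁.trans (hd₁ _ _ _).symm) (h₂.trans (hd₂ _ _ _).symm)⟩⟩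

/-- The pushout of a span of `κ`-presented algebras exists and is `κ`-presented. -/
theorem exists_isPushout (hκ : ℵ₀ ≤ κ) {A B C : KBool κ} (hA : IsPresented κ A)
    (hB : IsPresented κ B) (hC : IsPresented κ C) (f : C ⟶ A) (g : C ⟶ B) :
    ∃ (D : KBool κ) (i : A ⟶ D) (j : B ⟶ D), IsPresented κ D ∧ IsPushout f g i j := by
  obtain ⟨X, R, p, hX, hR, hp, hpR⟩ := hA.exists_presentation
  obtain ⟨Y, S, q, hY, hS, hq, hqS⟩ := hB.exists_presentation
  obtain ⟨Z, -, r, hZ, -, hr, -⟩ := hC.exists_presentation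
  choose s hs using fun z : Z => hp (f (r (gen z)))
  choose t ht using fun z : Z => hq (g (r (gen z)))
  let ι₁ : free κ X ⟶ free κ (X ⊕ Y) := lift _ fun x => gen (.inl x)
  let ι₂ : free κ Y ⟶ free κ (X ⊕ Y) := lift _ fun y => gen (.inr y)
  -- The relations of `A`, those of `B`, and one gluing relation for each generator of `C`.
  let T : R ⊕ S ⊕ Z → free κ (X ⊕ Y) × free κ (X ⊕ Y) :=
    Sum.elim (fun x => (ι₁ x.1.1, ι₁ x.1.2)) (Sum.elim (fun x => (ι₂ x.1.1, ι₂ x.1.2))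
      fun z => (ι₁ (s z), ι₂ (t z)))
  let c := Congruence.generate (Set.range T)
  have hT : ∀ k, c.proj (T k).1 = c.proj (T k).2 := fun k =>
    c.proj_eq.2 (Congruence.generate_of ⟨k, rfl⟩)
  let i : A ⟶ c.quotient := factor p hp (ι₁ ≫ c.proj) fun x y hxy =>
    Congruence.generate_le_ker _ (fun r hr => hT (.inl ⟨r, hr⟩)) ((hpR x y).1 hxy)
  let j : B ⟶ c.quotient := factor q hq (ι₂ ≫ c.proj) fun x y hxy =>
    Congruence.generate_le_ker _ (fun r hr => hT (.inr (.inl ⟨r, hr⟩))) ((hqS x y).1 hxy)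
  have hi : ∀ x, i (p x) = c.proj (ι₁ x) := factor_apply _ _ _ _
  have hj : ∀ x, j (q x) = c.proj (ι₂ x) := factor_apply _ _ _ _
  have w : f ≫ i = g ≫ j := by
    have : r ≫ f ≫ i = r ≫ g ≫ j := free_hom_ext' fun z => by
      change i (f (r (gen z))) = j (g (r (gen z)))
      rw [← hs, ← ht, hi, hj]
      exact hT (.inr (.inr z))
    refine ConcreteCategory.hom_ext _ _ fun x => ?_
    obtain ⟨z, rfl⟩ := hr x
    exact ConcreteCategory.congr_hom this z
  refine ⟨c.quotient, i, j, ⟨X ⊕ Y, Set.range T, ?_, ?_, ⟨OrderIso.refl _⟩⟩, ?_⟩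
  · rw [mk_sum, lift_id, lift_id]
    exact add_lt_of_lt hκ hX hY
  · refine mk_range_le.trans_lt ?_
    simp only [mk_sum, lift_id]
    exact add_lt_of_lt hκ hR (add_lt_of_lt hκ hS hZ)
  refine isPushout_of_exists_desc w (fun {E} u v huv => ?_) fun {E} d d' h₁ h₂ => ?_
  · let l : free κ (X ⊕ Y) ⟶ E := lift E (Sum.elim (fun x => u (p (gen x))) fun y => v (q (gen y)))
    have hl₁ : ∀ x, l (ι₁ x) = u (p x) := ConcreteCategory.congr_hom (f := ι₁ ≫ l) (g := p ≫ u)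
      (free_hom_ext' fun x => (congrArg l (lift_gen _ _ x)).trans (lift_gen _ _ _))
    have hl₂ : ∀ y, l (ι₂ y) = v (q y) := ConcreteCategory.congr_hom (f := ι₂ ≫ l) (g := q ≫ v)
      (free_hom_ext' fun y => (congrArg l (lift_gen _ _ y)).trans (lift_gen _ _ _))
    let d : c.quotient ⟶ E := factor c.proj c.proj_surjective l fun x y hxy => by
      refine Congruence.generate_le_ker l ?_ (c.proj_eq.1 hxy)
      rintro _ ⟨x | x | z, rfl⟩
      · change l (ι₁ _) = l (ι₁ _)
        rw [hl₁, hl₁, (hpR _ _).2 (Congruence.generate_of x.2)]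
      · change l (ι₂ _) = l (ι₂ _)
        rw [hl₂, hl₂, (hqS _ _).2 (Congruence.generate_of x.2)]
      · change l (ι₁ _) = l (ι₂ _)
        rw [hl₁, hl₂, hs, ht]
        exact ConcreteCategory.congr_hom huv (r (gen z))
    have hd : ∀ x, d (c.proj x) = l x := factor_apply _ _ _ _
    refine ⟨d, ConcreteCategory.hom_ext _ _ fun x => ?_, ConcreteCategory.hom_ext _ _ fun y => ?_⟩
    · obtain ⟨x, rfl⟩ := hp x
      change d (i (p x)) = u (p x)
      rw [hi, hd, hl₁]
    · obtain ⟨y, rfl⟩ := hq y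
      change d (j (q y)) = v (q y)
      rw [hj, hd, hl₂]
  · have h : c.proj ≫ d = c.proj ≫ d' := free_hom_ext' fun x => by
      change d (c.proj (gen x)) = d' (c.proj (gen x))
      rcases x with x | y
      -- Each generator comes from `ι₁` or `ι₂`, so its class lies in the image of `i` or `j`, where
      -- `d` and `d'` agree.
      · have := lift_gen (free κ (X ⊕ Y)) (fun x => gen (.inl x)) x
        rw [← this]
        change d (c.proj (ι₁ _)) = d' (c.proj (ι₁ _))
        rw [← hi]
        exact ConcreteCategory.congr_hom h₁ _
      · have := lift_gen (free κ (X ⊕ Y)) (fun y => gen (.inr y)) y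
        rw [← this]
        change d (c.proj (ι₂ _)) = d' (c.proj (ι₂ _))
        rw [← hj]
        exact ConcreteCategory.congr_hom h₂ _
    refine ConcreteCategory.hom_ext _ _ fun x => ?_
    obtain ⟨x, rfl⟩ := c.proj_surjective x
    exact ConcreteCategory.congr_hom h x

/-- The pushout of `A / a` along `f : A ⟶ B` is `B / f a`. -/
theorem exists_isPushout_elemCongruence {A B : KBool κ} (f : A ⟶ B) (a : A) :
    ∃ g : (elemCongruence A a).quotient ⟶ (elemCongruence B (f a)).quotient,
      IsPushout (elemCongruence A a).proj f g (elemCongruence B (f a)).proj := by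
  have hA := (elemCongruence A a).proj_surjective
  have hB := (elemCongruence B (f a)).proj_surjective
  obtain ⟨g, hg⟩ := exists_elemCongruence_proj_comp_eq (f ≫ (elemCongruence B (f a)).proj)
    (elemCongruence_proj_self (f a))
  refine ⟨g, isPushout_of_exists_desc hg (fun {E} u v huv => ?_) fun {E} d d' h₁ h₂ => ?_⟩
  · have hv : v (f a) = ⊤ := by
      have := ConcreteCategory.congr_hom huv a
      change u ((elemCongruence A a).proj a) = v (f a) at this
      rw [← this, elemCongruence_proj_self, map_top (ConcreteCategory.hom u)]
    obtain ⟨d, hd⟩ := exists_elemCongruence_proj_comp_eq v hv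
    refine ⟨d, ConcreteCategory.hom_ext _ _ fun x => ?_, hd⟩
    obtain ⟨x, rfl⟩ := hA x
    refine (congrArg d (ConcreteCategory.congr_hom hg x)).trans ?_
    exact (ConcreteCategory.congr_hom hd (f x)).trans (ConcreteCategory.congr_hom huv x).symm
  · refine ConcreteCategory.hom_ext _ _ fun x => ?_
    obtain ⟨x, rfl⟩ := hB x
    exact ConcreteCategory.congr_hom h₂ x

end KBool

/-! ### Subobjects in the opposite of the category of presented algebras. -/

namespace KBoolPres

variable {κ : Cardinal.{u}}

theorem hasPushouts (hκ : ℵ₀ ≤ κ) : HasPushouts (KBoolPres κ) := by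
  refine @hasPushouts_of_hasColimit_span _ _ fun {C A B f g} => ?_
  obtain ⟨D, i, j, hD, h⟩ := KBool.exists_isPushout hκ A.property B.property C.property f.hom g.hom
  have h' : IsPushout f g (ObjectProperty.homMk i : A ⟶ ⟨D, hD⟩) (ObjectProperty.homMk j) :=
    IsPushout.of_map_of_faithful (ObjectProperty.ι _) h
  exact h'.hasPushout

/-- Epimorphisms of `κ`-presented algebras are surjective. -/
theorem surjective_of_epi (hκ : ℵ₀ ≤ κ) {A B : KBoolPres κ} (f : A ⟶ B) [Epi f] :
    Function.Surjective f.hom := by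
  -- The cokernel pair of `f` in `KBool κ` is `κ`-presented, so an epimorphism of the subcategory
  -- forces `i = j`. This makes `f` epic among all `κ`-Boolean algebras.
  obtain ⟨D, i, j, hD, h⟩ :=
    KBool.exists_isPushout hκ B.property B.property A.property f.hom f.hom
  have hij : (ObjectProperty.homMk i : B ⟶ ⟨D, hD⟩) = ObjectProperty.homMk j :=
    (cancel_epi f).1 (ObjectProperty.hom_ext _ h.w)
  have hij' : i = j := congrArg (fun k => k.hom) hij
  subst hij'
  have : Epi f.hom := ⟨fun u v huv =>
    (h.inl_desc u v huv).symm.trans (h.inr_desc u v huv)⟩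
  exact KBool.surjective_of_epi f.hom hκ

variable (hκ : κ.IsRegular)

/-- The inequality of subobjects is a factorization of `A ⟶ A / a` through `A / b`. It exists
exactly when `b` becomes `⊤` in `A / a`, that is, when `a ≤ b`. -/
theorem mk_quotProj_le_iff {A : KBoolPres κ} {a b : A.obj} :
    Subobject.mk (quotProj hκ A a).op ≤ Subobject.mk (quotProj hκ A b).op ↔ a ≤ b := by
  constructor
  · intro h
    let g := Subobject.ofMkLEMk _ _ h
    have hg : quotProj hκ A b ≫ g.unop = quotProj hκ A a :=
      congrArg Quiver.Hom.unop (Subobject.ofMkLEMk_comp h)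
    have h₁ : ∀ x, g.unop.hom ((KBool.elemCongruence A.obj b).proj x) =
        (KBool.elemCongruence A.obj a).proj x :=
      ConcreteCategory.congr_hom (congrArg (fun k => k.hom) hg)
    rw [← KBool.elemCongruence_proj_eq_top, ← h₁, KBool.elemCongruence_proj_self]
    exact map_top (ConcreteCategory.hom g.unop.hom)
  · intro h
    obtain ⟨g, hg⟩ := KBool.exists_elemCongruence_proj_comp_eq
      (KBool.elemCongruence A.obj a).proj (KBool.elemCongruence_proj_eq_top.2 h)
    refine Subobject.mk_le_mk_of_comm
      (ObjectProperty.homMk g : quot hκ A b ⟶ quot hκ A a).op (Quiver.Hom.unop_inj ?_)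
    exact ObjectProperty.hom_ext _ hg

theorem exists_mk_quotProj_eq {A : KBoolPres κ} (P : Subobject (op A)) :
    ∃ a, Subobject.mk (quotProj hκ A a).op = P := by
  obtain ⟨X, m, hm, rfl⟩ := P.mk_surjective
  obtain ⟨a, ha, hker⟩ := KBool.exists_ker_eq_elemCongruence hκ.aleph0_le A.property
    X.unop.property m.unop.hom (surjective_of_epi hκ.aleph0_le m.unop)
  have hs := surjective_of_epi hκ.aleph0_le m.unop
  refine ⟨a, le_antisymm ?_ ?_⟩
  · refine Subobject.mk_le_mk_of_comm
      (ObjectProperty.homMk (KBool.factor m.unop.hom hs (KBool.elemCongruence A.obj a).proj hker) :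
        X.unop ⟶ quot hκ A a).op (Quiver.Hom.unop_inj (ObjectProperty.hom_ext _ ?_))
    exact ConcreteCategory.hom_ext _ _ (KBool.factor_apply _ hs _ hker)
  · obtain ⟨g, hg⟩ := KBool.exists_elemCongruence_proj_comp_eq m.unop.hom ha
    exact Subobject.mk_le_mk_of_comm
      (ObjectProperty.homMk g : quot hκ A a ⟶ X.unop).op
      (Quiver.Hom.unop_inj (ObjectProperty.hom_ext _ hg))

/-- The order isomorphism between `A` and the poset of subobjects of `A` in the opposite category,
which sends `a` to `A / a`. -/
noncomputable def subobjectIso (A : KBoolPres κ) : A.obj ≃o Subobject (op A) :=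
  RelIso.ofSurjective
    (OrderEmbedding.ofMapLEIff (fun a => Subobject.mk (quotProj hκ A a).op)
      fun _ _ => mk_quotProj_le_iff hκ)
    (exists_mk_quotProj_eq hκ)

/-- The pushout square of `A / a` and `B / f a` becomes a pullback square in the opposite category.
-/
theorem subobjectIso_map [HasPullbacks (KBoolPres κ)ᵒᵖ] {A B : KBoolPres κ} (f : A ⟶ B)
    (a : A.obj) : subobjectIso hκ B (f.hom a) =
      (Subobject.pullback f.op).obj (subobjectIso hκ A a) := by
  obtain ⟨g, hg⟩ := KBool.exists_isPushout_elemCongruence f.hom a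
  have h : IsPushout (quotProj hκ A a) f (ObjectProperty.homMk g : quot hκ A a ⟶ quot hκ B (f.hom a))
      (quotProj hκ B (f.hom a)) :=
    IsPushout.of_map_of_faithful (ObjectProperty.ι _) hg
  exact (Subobject.pullback_obj_mk h.flip.op).symm

end KBoolPres

theorem mainTheorem6 (κ : Cardinal.{u}) (hκ : κ.IsRegular) :
    (∀ (A B : KBool κ) (f : A ⟶ B), Epi f → Function.Surjective f) ∧
    ∃ _ : HasPullbacks (KBoolPres κ)ᵒᵖ,
      (∀ A : KBoolPres κ, KBool.IsPresented κ (Subobject (op A))) ∧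
      (∀ (A B : KBoolPres κ) (f : A ⟶ B) (ι : Type u) (P : ι → Subobject (op A))
        (Q : Subobject (op A)), #ι < κ →
        (IsLUB (Set.range P) Q → IsLUB (Set.range fun i => (Subobject.pullback f.op).obj (P i))
          ((Subobject.pullback f.op).obj Q)) ∧
        (IsGLB (Set.range P) Q → IsGLB (Set.range fun i => (Subobject.pullback f.op).obj (P i))
          ((Subobject.pullback f.op).obj Q))) ∧
      ∃ φ : ∀ A : KBoolPres κ, A.obj ≃o Subobject (op A),
        (∀ (A : KBoolPres κ) (a : A.obj), φ A a = Subobject.mk (KBoolPres.quotProj hκ A a).op ∧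
          ∃ e : (KBoolPres.quot hκ A a).obj ≃o Set.Iic a,
            ∀ x : A.obj, (e ((KBoolPres.quotProj hκ A a).hom x) : A.obj) = a ⊓ x) ∧
        ∀ (A B : KBoolPres κ) (f : A ⟶ B) (a : A.obj),
          φ B (f.hom a) = (Subobject.pullback f.op).obj (φ A a) := by
  refine ⟨fun A B f _ => KBool.surjective_of_epi f hκ.aleph0_le, ?_⟩
  have := KBoolPres.hasPushouts hκ.aleph0_le
  refine ⟨inferInstance, fun A => ?_, fun A B f ι P Q hι => ?_, KBoolPres.subobjectIso hκ,
    fun A a => ⟨rfl, KBool.exists_orderIso_Iic A.obj a⟩,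
    fun A B f a => KBoolPres.subobjectIso_map hκ f a⟩
  · obtain ⟨X, R, hX, hR, ⟨e⟩⟩ := A.property
    exact ⟨X, R, hX, hR, ⟨(KBoolPres.subobjectIso hκ A).symm.trans e⟩⟩
  -- Under the natural isomorphisms the pullback map is `f` itself, which preserves joins by
  -- definition and meets by complementation.
  · obtain ⟨p, rfl⟩ : ∃ p : ι → A.obj, P = fun i => KBoolPres.subobjectIso hκ A (p i) :=
      ⟨fun i => (KBoolPres.subobjectIso hκ A).symm (P i), by simp⟩
    obtain ⟨q, rfl⟩ := (KBoolPres.subobjectIso hκ A).surjective Q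
    simp only [← KBoolPres.subobjectIso_map]
    have hrange : ∀ (C : KBoolPres κ) (r : ι → C.obj),
        (Set.range fun i => KBoolPres.subobjectIso hκ C (r i)) =
          KBoolPres.subobjectIso hκ C '' Set.range r := fun C r => Set.range_comp _ r
    rw [hrange A, hrange B, OrderIso.isLUB_image', OrderIso.isLUB_image', OrderIso.isGLB_image',
      OrderIso.isGLB_image']
    exact ⟨fun h => (ConcreteCategory.hom f.hom).map_isLUB hι h,
      fun h => KBool.map_isGLB f.hom hι h⟩
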